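/- An $r$-graph $H$ consists of a finite vertex set $V(H)$ and an edge set $E(H)\subseteq\binom{V(H)}{r}$. A set of vertices is a clique if all of its $r$-subsets are edges, a coclique if none of them is, and homogeneous if it is a clique or a coclique; $h(H)$ denotes the size of a largest homogeneous set of $H$. For a set $Q$ of pairs $(m,f)$, $H$ is called $Q$-free if for every $(m,f)\in Q$ no $m$ vertices of $H$ induce exactly $f$ edges. Let $h_r(n,Q)$ be the minimum of $h(H)$ over all $n$-vertex $Q$-free $r$-graphs $H$. Theorem. Let $n\ge 4$. Then $$h_3(n,\{(4,0),(4,2),(4,3)\})=n-1$$ and $$h_3(n,\{(4,0),(4,1),(4,3)\})=\begin{cases}\dfrac n2 & \text{if } n\equiv 0 \pmod 6,\\[4pt] \left\lceil\dfrac{n+1}{2}\right\rceil & \text{if } n\not\equiv 0\pmod 6.\end{cases}$$ -/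

import Mathlib

/-- An `r`-graph (`r`-uniform hypergraph) on the vertex type `V`: a finite set of edges, each of
which is a set of exactly `r` vertices. -/
structure RGraph (r : ℕ) (V : Type*) where
  /-- the edge set -/
  edges : Finset (Finset V)
  /-- every edge has exactly `r` vertices -/
  card_of_mem : ∀ e ∈ edges, e.card = r

namespace RGraph

variable {r : ℕ} {V : Type*}

/-- `S` is a clique: every `r`-element subset of `S` is an edge. -/
def IsClique (H : RGraph r V) (S : Finset V) : Prop :=
  ∀ e : Finset V, e ⊆ S → e.card = r → e ∈ H.edges

/-- `S` is a coclique (independent set): no edge is contained in `S`. -/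
def IsCoclique (H : RGraph r V) (S : Finset V) : Prop :=
  ∀ e ∈ H.edges, ¬ e ⊆ S

/-- A homogeneous set is a clique or a coclique. -/
def IsHomogeneous (H : RGraph r V) (S : Finset V) : Prop :=
  H.IsClique S ∨ H.IsCoclique S

open Classical in
/-- `h(H)`: the size of a largest homogeneous set of `H`. -/
noncomputable def homNumber [Fintype V] (H : RGraph r V) : ℕ :=
  (Finset.univ.filter fun S : Finset V => H.IsHomogeneous S).sup Finset.card

open Classical in
/-- The number of edges of the subgraph of `H` induced by the vertex set `S`. -/
noncomputable def inducedSize (H : RGraph r V) (S : Finset V) : ℕ :=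
  (H.edges.filter fun e => e ⊆ S).card

/-- `H` is `Q`-free: for every order-size pair `(m, f)` in `Q`, no `m` vertices of `H` induce
exactly `f` edges. -/
def IsFree (H : RGraph r V) (Q : Set (ℕ × ℕ)) : Prop :=
  ∀ p ∈ Q, ∀ S : Finset V, S.card = p.1 → H.inducedSize S ≠ p.2

end RGraph

/-- `IsMinHomNumber r n Q k` says `h_r(n, Q) = k`: the number `k` is the minimum of `h(H)` over all
`Q`-free `r`-graphs `H` on `n` vertices (in particular, such an `H` with `h(H) = k` exists). -/
def IsMinHomNumber (r n : ℕ) (Q : Set (ℕ × ℕ)) (k : ℕ) : Prop :=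
  IsLeast {j : ℕ | ∃ H : RGraph r (Fin n), H.IsFree Q ∧ H.homNumber = j} k

namespace RGraph

/-! ### Induced sizes, cliques and cocliques in 3-graphs. -/

section General

variable {V : Type*} [DecidableEq V]

/-! Excluding `(4, 0)` keeps cocliques to three vertices, so both values are decided by cliques. In
the first family every four vertices span one or four edges. A non-edge and an edge sharing two
vertices force all triples through one vertex to be non-edges and all others to be edges
(`exists_clique_of_one_or_four`).

In the second family every four vertices span two or four edges, so the non-edges form a two-graph
in which no four vertices span four triples. Fix a vertex `v`: the non-edges are the triples
spanning an odd number of edges of the link graph of `v`, and this link is triangle-free. Either the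
vertices split into two cliques, and nested neighbourhoods yield a clique on more than half of them
(`exists_isCoherent_of_compl`), or the link contains an induced pentagon. Then everything is a
blow-up of a pentagon plus an isolated vertex, and averaging over ten cliques gives at least `n /
2`, with equality only for six equal classes (`exists_isCoherent_of_pentagon`). A half graph and the
balanced blow-up are extremal. -/

open Classical in
theorem inducedSize_quad (H : RGraph 3 V) {x y z w : V} (hxy : x ≠ y) (hxz : x ≠ z) (hxw : x ≠ w)
    (hyz : y ≠ z) (hyw : y ≠ w) (hzw : z ≠ w) :
    H.inducedSize {x, y, z, w} =
      (if {x, y, z} ∈ H.edges then 1 else 0) + (if {x, y, w} ∈ H.edges then 1 else 0) +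
      (if {x, z, w} ∈ H.edges then 1 else 0) + (if {y, z, w} ∈ H.edges then 1 else 0) := by
  have key : (H.edges.filter fun e => e ⊆ ({x, y, z, w} : Finset V)) =
      ({{x, y, z}, {x, y, w}, {x, z, w}, {y, z, w}} : Finset (Finset V)).filter
        (· ∈ H.edges) := by
    ext e
    simp only [Finset.mem_filter, Finset.mem_insert, Finset.mem_singleton]
    constructor
    · rintro ⟨he, hs⟩
      refine ⟨?_, he⟩
      have hc := H.card_of_mem e he
      have h4 : ({x, y, z, w} : Finset V).card = 4 := by
        rw [Finset.card_eq_succ]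
        exact ⟨x, {y, z, w}, by simp [hxy, hxz, hxw], rfl,
          Finset.card_eq_three.2 ⟨y, z, w, hyz, hyw, hzw, rfl⟩⟩
      have h1 : (({x, y, z, w} : Finset V) \ e).card = 1 := by
        rw [Finset.card_sdiff_of_subset hs]; omega
      obtain ⟨u, hu⟩ := Finset.card_eq_one.1 h1
      have he' : e = ({x, y, z, w} : Finset V) \ {u} := by
        rw [← hu, Finset.sdiff_sdiff_eq_self hs]
      have hu' : u ∈ ({x, y, z, w} : Finset V) := by
        have : u ∈ ({x, y, z, w} : Finset V) \ e := by rw [hu]; simp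
        exact (Finset.mem_sdiff.1 this).1
      simp only [Finset.mem_insert, Finset.mem_singleton] at hu'
      rcases hu' with rfl | rfl | rfl | rfl
      · right; right; right; rw [he']; ext t; simp; grind
      · right; right; left; rw [he']; ext t; simp; grind
      · right; left; rw [he']; ext t; simp; grind
      · left; rw [he']; ext t; simp; grind
    · rintro ⟨h | h | h | h, he⟩ <;> subst h <;> refine ⟨he, ?_⟩ <;> intro t <;> simp <;> tauto
  have hne : ∀ {a : V} {s t : Finset V}, a ∈ s → a ∉ t → s ≠ t := by
    rintro a s t h1 h2 rfl; exact h2 h1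
  unfold inducedSize
  refine Eq.trans (by congr) ((congrArg Finset.card key).trans ?_)
  rw [Finset.card_filter, Finset.sum_insert, Finset.sum_insert, Finset.sum_insert,
    Finset.sum_singleton]
  · ring
  · simp only [Finset.mem_singleton]
    exact hne (a := x) (by simp) (by simp [hxy, hxz, hxw])
  · simp only [Finset.mem_insert, Finset.mem_singleton, not_or]
    exact ⟨hne (a := y) (by simp) (by simp [hxy.symm, hyz, hyw]),
      hne (a := x) (by simp) (by simp [hxy, hxz, hxw])⟩
  · simp only [Finset.mem_insert, Finset.mem_singleton, not_or]
    exact ⟨hne (a := z) (by simp) (by simp [hxz.symm, hyz.symm, hzw]),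
      hne (a := y) (by simp) (by simp [hxy.symm, hyz, hyw]),
      hne (a := x) (by simp) (by simp [hxy, hxz, hxw])⟩

theorem isFree_iff (H : RGraph 3 V) (a b c : ℕ) :
    H.IsFree {(4, a), (4, b), (4, c)} ↔
      ∀ x y z w : V, x ≠ y → x ≠ z → x ≠ w → y ≠ z → y ≠ w → z ≠ w →
        H.inducedSize {x, y, z, w} ≠ a ∧ H.inducedSize {x, y, z, w} ≠ b ∧
        H.inducedSize {x, y, z, w} ≠ c := by
  constructor
  · intro h x y z w hxy hxz hxw hyz hyw hzw
    have h4 : ({x, y, z, w} : Finset V).card = 4 := by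
      rw [Finset.card_eq_succ]
      exact ⟨x, {y, z, w}, by simp [hxy, hxz, hxw], rfl,
        Finset.card_eq_three.2 ⟨y, z, w, hyz, hyw, hzw, rfl⟩⟩
    exact ⟨h (4, a) (by simp) _ h4, h (4, b) (by simp) _ h4, h (4, c) (by simp) _ h4⟩
  · intro h p hp S hS
    have hS4 : S.card = 4 := by
      rcases hp with rfl | rfl | rfl <;> exact hS
    obtain ⟨x, T, hxT, rfl, hT⟩ := Finset.card_eq_succ.1 hS4
    obtain ⟨y, z, w, hyz, hyw, hzw, rfl⟩ := Finset.card_eq_three.1 hT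
    simp only [Finset.mem_insert, Finset.mem_singleton, not_or] at hxT
    have := h x y z w hxT.1 hxT.2.1 hxT.2.2 hyz hyw hzw
    rcases hp with rfl | rfl | rfl
    exacts [this.1, this.2.1, this.2.2]

theorem isClique_iff (H : RGraph 3 V) (S : Finset V) :
    H.IsClique S ↔ ∀ x ∈ S, ∀ y ∈ S, ∀ z ∈ S, x ≠ y → x ≠ z → y ≠ z → {x, y, z} ∈ H.edges := by
  constructor
  · intro h x hx y hy z hz hxy hxz hyz
    refine h _ ?_ (Finset.card_eq_three.2 ⟨x, y, z, hxy, hxz, hyz, rfl⟩)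
    intro t; simp; rintro (rfl | rfl | rfl) <;> assumption
  · intro h e he hc
    obtain ⟨x, y, z, hxy, hxz, hyz, rfl⟩ := Finset.card_eq_three.1 hc
    exact h x (he (by simp)) y (he (by simp)) z (he (by simp)) hxy hxz hyz

theorem card_le_of_isCoclique {V : Type*} {H : RGraph 3 V} {Q : Set (ℕ × ℕ)} (hQ : (4, 0) ∈ Q)
    (h : H.IsFree Q) {S : Finset V} (hS : H.IsCoclique S) : S.card ≤ 3 := by
  classical
  by_contra hc
  obtain ⟨U, hU, hU4⟩ := Finset.exists_subset_card_eq (show 4 ≤ S.card by omega)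
  refine h _ hQ U hU4 ?_
  simp only [inducedSize, Finset.card_eq_zero, Finset.filter_eq_empty_iff]
  exact fun e he heU => hS e he (heU.trans hU)

theorem card_le_homNumber {V : Type*} [Fintype V] {H : RGraph 3 V} {S : Finset V} (hS : H.IsClique S) :
    S.card ≤ H.homNumber := by
  classical
  exact Finset.le_sup (f := Finset.card) (Finset.mem_filter.2 ⟨Finset.mem_univ _, Or.inl hS⟩)

theorem homNumber_le {V : Type*} [Fintype V] {H : RGraph 3 V} {Q : Set (ℕ × ℕ)} (hQ : (4, 0) ∈ Q) (h : H.IsFree Q)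
    {k : ℕ} (hk : 3 ≤ k) (hS : ∀ S, H.IsClique S → S.card ≤ k) : H.homNumber ≤ k := by
  classical
  refine Finset.sup_le fun S hS' => ?_
  rcases (Finset.mem_filter.1 hS').2 with h1 | h1
  · exact hS S h1
  · exact (card_le_of_isCoclique hQ h h1).trans hk

variable [Fintype V]

/-- The `3`-graph whose edges are the triples satisfying `P` (in some order). -/
def ofPred (P : V → V → V → Bool) : RGraph 3 V where
  edges := (Finset.univ.powersetCard 3).filter fun e => ∃ x y z, e = {x, y, z} ∧ P x y z = true
  card_of_mem _ he := (Finset.mem_powersetCard.1 (Finset.mem_filter.1 he).1).2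

theorem mem_ofPred {P : V → V → V → Bool} (h1 : ∀ x y z, P x y z = P y x z)
    (h2 : ∀ x y z, P x y z = P x z y) {x y z : V} (hxy : x ≠ y) (hxz : x ≠ z) (hyz : y ≠ z) :
    {x, y, z} ∈ (ofPred P).edges ↔ P x y z = true := by
  simp only [ofPred, Finset.mem_filter, Finset.mem_powersetCard, Finset.subset_univ, true_and]
  constructor
  · rintro ⟨_, a, b, c, he, hP⟩
    have hx : x ∈ ({a, b, c} : Finset V) := he ▸ (by simp)
    have hy : y ∈ ({a, b, c} : Finset V) := he ▸ (by simp)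
    have hz : z ∈ ({a, b, c} : Finset V) := he ▸ (by simp)
    simp only [Finset.mem_insert, Finset.mem_singleton] at hx hy hz
    clear he
    grind
  · exact fun hP => ⟨Finset.card_eq_three.2 ⟨x, y, z, hxy, hxz, hyz, rfl⟩, x, y, z, rfl, hP⟩

end General

/-! ### Four vertices spanning one or four edges. -/

section OneOrFour

/-- A quadruple containing a non-edge has exactly one edge. If `bce` were a non-edge, then `abd`,
`acd`, `bde`, `cde` would be non-edges too, leaving exactly one edge in each pair from `abe`, `ace`,
`ade`, which parity forbids. -/
theorem mem_edges_extend {V : Type*} [DecidableEq V] {H : RGraph 3 V}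
    (hH : H.IsFree {(4, 0), (4, 2), (4, 3)}) {a b c d e : V} (hab : a ≠ b) (hac : a ≠ c)
    (had : a ≠ d) (hbc : b ≠ c) (hbd : b ≠ d) (hcd : c ≠ d) (hae : a ≠ e) (hbe : b ≠ e)
    (hce : c ≠ e) (habc : {a, b, c} ∉ H.edges) (hbcd : {b, c, d} ∈ H.edges) :
    {b, c, e} ∈ H.edges := by
  rcases eq_or_ne d e with rfl | hde
  · exact hbcd
  rw [isFree_iff] at hH
  have q1 := hH a b c d hab hac had hbc hbd hcd
  have q2 := hH a b c e hab hac hae hbc hbe hce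
  have q3 := hH a b d e hab had hae hbd hbe hde
  have q4 := hH a c d e hac had hae hcd hce hde
  have q5 := hH b c d e hbc hbd hbe hcd hce hde
  rw [inducedSize_quad] at q1 q2 q3 q4 q5 <;> try assumption
  by_contra hbce
  simp only [habc, hbcd, hbce, if_true, if_false] at q1 q2 q3 q4 q5
  split_ifs at q1 q2 q3 q4 q5 <;> omega

theorem not_mem_edges_of_mem {V : Type*} [DecidableEq V] {H : RGraph 3 V}
    (hH : H.IsFree {(4, 0), (4, 2), (4, 3)}) {a b c e : V} (hab : a ≠ b) (hac : a ≠ c)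
    (hbc : b ≠ c) (hae : a ≠ e) (hbe : b ≠ e) (hce : c ≠ e) (habc : {a, b, c} ∉ H.edges)
    (hbce : {b, c, e} ∈ H.edges) : {a, b, e} ∉ H.edges := by
  rw [isFree_iff] at hH
  have q := hH a b c e hab hac hae hbc hbe hce
  rw [inducedSize_quad] at q <;> try assumption
  intro habe
  simp only [habc, hbce, habe, if_true, if_false] at q
  split_ifs at q <;> omega

theorem exists_clique_of_one_or_four {V : Type*} [DecidableEq V] [Fintype V] {H : RGraph 3 V}
    (hH : H.IsFree {(4, 0), (4, 2), (4, 3)}) (hn : 4 ≤ Fintype.card V) :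
    ∃ S, H.IsClique S ∧ Fintype.card V - 1 ≤ S.card := by
  by_cases hcl : H.IsClique Finset.univ
  · exact ⟨_, hcl, by simp⟩
  rw [isClique_iff] at hcl
  push Not at hcl
  obtain ⟨x, -, y, -, z, -, hxy, hxz, hyz, hE⟩ := hcl
  have hex : ∃ w, w ∉ ({x, y, z} : Finset V) := by
    by_contra! hc
    have := Finset.card_le_three (a := x) (b := y) (c := z)
    rw [Finset.eq_univ_iff_forall.2 hc, Finset.card_univ] at this
    omega
  obtain ⟨w, hw⟩ := hex
  simp only [Finset.mem_insert, Finset.mem_singleton, not_or] at hw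
  have hxw : x ≠ w := Ne.symm hw.1
  have hyw : y ≠ w := Ne.symm hw.2.1
  have hzw : z ≠ w := Ne.symm hw.2.2
  obtain ⟨a, b, c, d, hab, hac, had, hbc, hbd, hcd, habc, hbcd⟩ : ∃ a b c d : V,
      a ≠ b ∧ a ≠ c ∧ a ≠ d ∧ b ≠ c ∧ b ≠ d ∧ c ≠ d ∧ {a, b, c} ∉ H.edges ∧
      {b, c, d} ∈ H.edges := by
    have q := (isFree_iff H _ _ _).1 hH x y z w hxy hxz hxw hyz hyw hzw
    rw [inducedSize_quad] at q <;> try assumption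
    by_cases h1 : {y, z, w} ∈ H.edges
    · exact ⟨x, y, z, w, hxy, hxz, hxw, hyz, hyw, hzw, hE, h1⟩
    by_cases h2 : {x, z, w} ∈ H.edges
    · exact ⟨y, x, z, w, hxy.symm, hyz, hyw, hxz, hxw, hzw,
        by rwa [Finset.insert_comm], h2⟩
    by_cases h3 : {x, y, w} ∈ H.edges
    · refine ⟨z, x, y, w, hxz.symm, hyz.symm, hzw, hxy, hxw, hyw, ?_, h3⟩
      rwa [Finset.insert_comm, Finset.pair_comm]
    simp [hE, h1, h2, h3] at q
  -- `P p q` records that the pair already behaves as if `a` were the exceptional vertex. Exchanging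
  -- one vertex at a time carries this from `b, c` to every pair avoiding `a`.
  let P : V → V → Prop := fun p q => {a, p, q} ∉ H.edges ∧
    ∀ e, e ≠ a → e ≠ p → e ≠ q → {p, q, e} ∈ H.edges
  have hP : P b c := ⟨habc, fun e ha hb hc =>
    mem_edges_extend hH hab hac had hbc hbd hcd ha.symm hb.symm hc.symm habc hbcd⟩
  have hsymm : ∀ {p q}, P p q → P q p := fun {p q} h =>
    ⟨by rw [Finset.pair_comm]; exact h.1, fun e ha hp hq => by
      rw [Finset.insert_comm]; exact h.2 e ha hq hp⟩
  have hstep : ∀ {p q r}, p ≠ q → a ≠ p → a ≠ q → r ≠ a → r ≠ p → P p q → P p r := by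
    intro p q r hpq hap haq hra hrp h
    rcases eq_or_ne r q with rfl | hrq
    · exact h
    have h1 := h.2 r hra hrp hrq
    have h2 := not_mem_edges_of_mem hH hap haq hpq hra.symm hrp.symm hrq.symm h.1 h1
    refine ⟨h2, fun e hea hep her => ?_⟩
    refine mem_edges_extend hH hap hra.symm haq hrp.symm hpq hrq hea.symm hep.symm her.symm h2
      (d := q) ?_
    rwa [Finset.pair_comm]
  refine ⟨Finset.univ.erase a, ?_, by simp⟩
  rw [isClique_iff]
  intro x hx y hy z hz hxy hxz hyz
  have hxa := Finset.ne_of_mem_erase hx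
  have hya := Finset.ne_of_mem_erase hy
  have hza := Finset.ne_of_mem_erase hz
  have hPxy : P x y := by
    rcases eq_or_ne x b with rfl | hxb
    · exact hstep hbc hab hac hya hxy.symm hP
    · exact hstep hxb hxa.symm hab hya hxy.symm (hsymm (hstep hbc hab hac hxa hxb hP))
  exact hPxy.2 z hza hxz.symm hyz.symm

theorem isMinHomNumber_one_or_four (n : ℕ) (hn : 4 ≤ n) :
    IsMinHomNumber 3 n {(4, 0), (4, 2), (4, 3)} (n - 1) := by
  constructor
  · let o : Fin n := ⟨0, by omega⟩
    -- Extremal example: a complete 3-graph together with the isolated vertex `o`.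
    let P : Fin n → Fin n → Fin n → Bool := fun x y z => x != o && (y != o && z != o)
    have hmem : ∀ {x y z}, x ≠ y → x ≠ z → y ≠ z →
        ({x, y, z} ∈ (ofPred P).edges ↔ x ≠ o ∧ y ≠ o ∧ z ≠ o) := by
      intro x y z hxy hxz hyz
      rw [mem_ofPred _ _ hxy hxz hyz]
      · simp [P]
      · intro x y z; simp only [P]; ac_rfl
      · intro x y z; simp only [P]; ac_rfl
    have hfree : (ofPred P).IsFree {(4, 0), (4, 2), (4, 3)} := by
      rw [isFree_iff]
      intro x y z w hxy hxz hxw hyz hyw hzw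
      rw [inducedSize_quad _ hxy hxz hxw hyz hyw hzw]
      simp only [hmem, hxy, hxz, hxw, hyz, hyw, hzw, ne_eq, not_false_eq_true]
      by_cases hx : x = o
      · subst hx; simp [hxy.symm, hxz.symm, hxw.symm]
      by_cases hy : y = o
      · subst hy; simp [hx, hyz.symm, hyw.symm]
      by_cases hz : z = o
      · subst hz; simp [hx, hy, hzw.symm]
      by_cases hw : w = o
      · subst hw; simp [hx, hy, hz]
      simp [hx, hy, hz, hw]
    refine ⟨ofPred P, hfree, le_antisymm ?_ ?_⟩
    · refine homNumber_le (by simp) hfree (by omega) fun S hS => ?_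
      by_contra hc
      have hSu : S = Finset.univ := by
        rw [← Finset.card_eq_iff_eq_univ, Fintype.card_fin]
        have := Finset.card_le_univ S
        rw [Fintype.card_fin] at this
        omega
      subst hSu
      rw [isClique_iff] at hS
      have := hS o (Finset.mem_univ _) ⟨1, by omega⟩ (Finset.mem_univ _) ⟨2, by omega⟩
        (Finset.mem_univ _) (by simp [o]) (by simp [o]) (by simp)
      rw [hmem (by simp [o]) (by simp [o]) (by simp)] at this
      exact this.1 rfl
    · have h := card_le_homNumber (H := ofPred P) (S := Finset.univ.erase o) (by
        rw [isClique_iff]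
        intro x hx y hy z hz hxy hxz hyz
        exact (hmem hxy hxz hyz).2 ⟨Finset.ne_of_mem_erase hx, Finset.ne_of_mem_erase hy,
          Finset.ne_of_mem_erase hz⟩)
      simpa using h
  · rintro j ⟨H, hH, rfl⟩
    obtain ⟨S, hS, hc⟩ := exists_clique_of_one_or_four hH (by simpa using hn)
    rw [Fintype.card_fin] at hc
    exact hc.trans (card_le_homNumber hS)

end OneOrFour

/-! ### Four vertices spanning two or four edges: two-graphs. -/

section TwoOrFour

/-- A two-graph, given by the indicator `T` of its set of triples, in which no four vertices span
four triples. -/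
structure IsK4FreeTwoGraph {V : Type*} (T : V → V → V → Bool) : Prop where
  swap_left : ∀ x y z, T x y z = T y x z
  swap_right : ∀ x y z, T x y z = T x z y
  diag : ∀ x y, T x x y = false
  cocycle : ∀ x y z w, (T x y z ^^ T x y w ^^ T x z w ^^ T y z w) = false
  k4free : ∀ x y z w, ¬ (T x y z = true ∧ T x y w = true ∧ T x z w = true ∧ T y z w = true)

open Classical in
/-- The indicator of the non-edges of a `3`-graph. -/
noncomputable def nonEdge {V : Type*} (H : RGraph 3 V) (x y z : V) : Bool :=
  decide (x ≠ y ∧ x ≠ z ∧ y ≠ z ∧ {x, y, z} ∉ H.edges)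

-- Quadruples have zero or two non-edges: evenness is the cocycle identity, and four is excluded.
open Classical in
theorem isK4FreeTwoGraph_nonEdge {V : Type*} {H : RGraph 3 V}
    (hH : H.IsFree {(4, 0), (4, 1), (4, 3)}) : IsK4FreeTwoGraph H.nonEdge := by
  have s1 : ∀ x y z, H.nonEdge x y z = H.nonEdge y x z := by
    intro x y z
    simp only [nonEdge, decide_eq_decide, Finset.insert_comm x y, ne_comm (a := x) (b := y)]
    tauto
  have s2 : ∀ x y z, H.nonEdge x y z = H.nonEdge x z y := by
    intro x y z
    simp only [nonEdge, decide_eq_decide, Finset.pair_comm y z, ne_comm (a := y) (b := z)]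
    tauto
  have d1 : ∀ x y, H.nonEdge x x y = false := by simp [nonEdge]
  have d2 : ∀ x y, H.nonEdge x y x = false := by simp [nonEdge]
  have d3 : ∀ x y, H.nonEdge x y y = false := by simp [nonEdge]
  rw [isFree_iff] at hH
  have key : ∀ x y z w, x ≠ y → x ≠ z → x ≠ w → y ≠ z → y ≠ w → z ≠ w →
      (H.nonEdge x y z ^^ H.nonEdge x y w ^^ H.nonEdge x z w ^^ H.nonEdge y z w) = false ∧
      ¬ (H.nonEdge x y z = true ∧ H.nonEdge x y w = true ∧ H.nonEdge x z w = true ∧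
        H.nonEdge y z w = true) := by
    intro x y z w hxy hxz hxw hyz hyw hzw
    have q := hH x y z w hxy hxz hxw hyz hyw hzw
    rw [inducedSize_quad _ hxy hxz hxw hyz hyw hzw] at q
    by_cases h1 : {x, y, z} ∈ H.edges <;> by_cases h2 : {x, y, w} ∈ H.edges <;>
      by_cases h3 : {x, z, w} ∈ H.edges <;> by_cases h4 : {y, z, w} ∈ H.edges <;>
      simp [h1, h2, h3, h4] at q <;> simp [nonEdge, *]
  refine ⟨s1, s2, d1, fun x y z w => ?_, fun x y z w => ?_⟩
  · rcases eq_or_ne x y with rfl | hxy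
    · simp [d1]
    rcases eq_or_ne x z with rfl | hxz
    · simp [d1, d2, s1 y x w]
    rcases eq_or_ne x w with rfl | hxw
    · simp [d2, s2 y z x, s1 y x z]
    rcases eq_or_ne y z with rfl | hyz
    · simp [d1, d3]
    rcases eq_or_ne y w with rfl | hyw
    · simp [d2, d3, s2 x z y]
    rcases eq_or_ne z w with rfl | hzw
    · simp [d3]
    exact (key x y z w hxy hxz hxw hyz hyw hzw).1
  · rintro ⟨h1, h2, h3, h4⟩
    have h1' := h1; have h2' := h2; have h3' := h3
    simp only [nonEdge, decide_eq_true_eq] at h1' h2' h3'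
    exact (key x y z w h1'.1 h1'.2.1 h2'.2.1 h1'.2.2.1 h2'.2.2.1 h3'.2.2.1).2 ⟨h1, h2, h3, h4⟩

/-- `S` spans no triple of `T`. -/
def IsCoherent {V : Type*} (T : V → V → V → Bool) (S : Finset V) : Prop :=
  ∀ x ∈ S, ∀ y ∈ S, ∀ z ∈ S, T x y z = false

theorem isClique_of_isCoherent {V : Type*} {H : RGraph 3 V} {S : Finset V}
    (h : IsCoherent H.nonEdge S) : H.IsClique S := by
  classical
  rw [isClique_iff]
  intro x hx y hy z hz hxy hxz hyz
  have := h x hx y hy z hz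
  by_contra hc
  simp only [nonEdge, decide_eq_false_iff_not] at this
  refine this ⟨hxy, hxz, hyz, ?_⟩
  convert hc

namespace IsK4FreeTwoGraph

variable {V : Type*} {T : V → V → V → Bool}

theorem diag' (h : IsK4FreeTwoGraph T) (x y : V) : T x y x = false := by
  rw [h.swap_right, h.diag]

theorem diag'' (h : IsK4FreeTwoGraph T) (x y : V) : T x y y = false := by
  rw [h.swap_left, h.diag']

/-- The link of `v` determines the two-graph; this reduces questions about triples to a graph in
which `v` is isolated. -/
theorem eq_xor (h : IsK4FreeTwoGraph T) (v x y z : V) :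
    T x y z = (T v x y ^^ T v x z ^^ T v y z) := by
  have := h.cocycle v x y z
  revert this
  cases T x y z <;> cases T v x y <;> cases T v x z <;> cases T v y z <;> simp

theorem isCoherent_insert [DecidableEq V] (h : IsK4FreeTwoGraph T) {S : Finset V} {b : V}
    (hS : IsCoherent T S) (hb : ∀ x ∈ S, ∀ y ∈ S, T b x y = false) :
    IsCoherent T (insert b S) := by
  intro x hx y hy z hz
  rcases Finset.mem_insert.1 hx with rfl | hx' <;>
    rcases Finset.mem_insert.1 hy with rfl | hy' <;>
    rcases Finset.mem_insert.1 hz with rfl | hz'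
  · exact h.diag _ _
  · exact h.diag _ _
  · exact h.diag' _ _
  · exact hb _ hy' _ hz'
  · exact h.diag'' _ _
  · rw [h.swap_left]; exact hb _ hx' _ hz'
  · rw [h.swap_right, h.swap_left]; exact hb _ hx' _ hy'
  · exact hS x hx' y hy' z hz'

variable [Fintype V] [DecidableEq V]

/-- If the vertices split into two coherent sets, the bipartite graph between them (in a suitable
member of the switching class) has nested neighbourhoods, so some vertex can change sides. -/
theorem exists_isCoherent_of_compl (h : IsK4FreeTwoGraph T) (hn : 2 ≤ Fintype.card V)
    {A : Finset V} (hA : IsCoherent T A) (hB : IsCoherent T Aᶜ) :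
    ∃ S, IsCoherent T S ∧ Fintype.card V / 2 + 1 ≤ S.card := by
  have hc := Finset.card_add_card_compl A
  by_cases h1 : Fintype.card V / 2 + 1 ≤ A.card
  · exact ⟨A, hA, h1⟩
  by_cases h2 : Fintype.card V / 2 + 1 ≤ Aᶜ.card
  · exact ⟨_, hB, h2⟩
  have hA1 : A.card = Fintype.card V / 2 := by omega
  have hB1 : Aᶜ.card = Fintype.card V / 2 := by omega
  obtain ⟨v, hv⟩ : A.Nonempty := Finset.card_pos.1 (by omega)
  obtain ⟨w, hw⟩ : Aᶜ.Nonempty := Finset.card_pos.1 (by omega)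
  -- Switching makes both sides independent: a triple meeting both sides is then in `T` exactly when
  -- its two cross pairs differ in `G`.
  let G : V → V → Bool := fun a b => T v a b ^^ T v w b
  have hG1 : ∀ a ∈ A, ∀ a' ∈ A, ∀ b, T a a' b = (G a b ^^ G a' b) := by
    intro a ha a' ha' b
    rw [h.eq_xor v, hA v hv a ha a' ha']
    simp only [G]
    cases T v a b <;> cases T v a' b <;> cases T v w b <;> rfl
  have hG2 : ∀ a, ∀ b ∈ Aᶜ, ∀ b' ∈ Aᶜ, T a b b' = (G a b ^^ G a b') := by
    intro a b hb b' hb'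
    have h3 := h.eq_xor v w b b'
    rw [hB w hw b hb b' hb'] at h3
    rw [h.eq_xor v]
    simp only [G]
    revert h3
    cases T v a b <;> cases T v a b' <;> cases T v w b <;> cases T v w b' <;>
      cases T v b b' <;> simp
  -- A vertex `a` of maximal degree either sees all of the other side and can move there, or misses
  -- some `b`. In the latter case nestedness isolates `b`, which can move instead.
  obtain ⟨a, ha, hmax⟩ :=
    Finset.exists_max_image A (fun a => (Aᶜ.filter fun b => G a b = true).card) ⟨v, hv⟩
  by_cases hall : ∀ b ∈ Aᶜ, G a b = true
  · refine ⟨insert a Aᶜ, h.isCoherent_insert hB fun b hb b' hb' => ?_, ?_⟩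
    · rw [hG2 a b hb b' hb', hall b hb, hall b' hb']; rfl
    · rw [Finset.card_insert_of_notMem (by simpa using ha)]; omega
  · push Not at hall
    obtain ⟨b, hb, hab⟩ := hall
    rw [ne_eq, Bool.not_eq_true] at hab
    have hiso : ∀ a' ∈ A, G a' b = false := by
      intro a' ha'
      by_contra hab'
      rw [Bool.not_eq_false] at hab'
      obtain ⟨b', hb', h3, h4⟩ : ∃ b' ∈ Aᶜ, G a b' = true ∧ G a' b' = false := by
        by_contra! hcon
        refine absurd (hmax a' ha') (not_le.2 (Finset.card_lt_card ?_))
        rw [Finset.ssubset_iff_of_subset]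
        · exact ⟨b, by simp [hab', Finset.mem_compl.1 hb], by simp [hab]⟩
        · intro t ht
          rw [Finset.mem_filter] at ht ⊢
          exact ⟨ht.1, by simpa using hcon t ht.1 ht.2⟩
      -- The cross edges among these four are exactly `a b'` and `a' b`; such a matching makes all
      -- four triples odd.
      refine h.k4free a a' b b' ⟨?_, ?_, ?_, ?_⟩
      · rw [hG1 a ha a' ha', hab, hab']; rfl
      · rw [hG1 a ha a' ha', h3, h4]; rfl
      · rw [hG2 a b hb b' hb', h3, hab]; rfl
      · rw [hG2 a' b hb b' hb', h4, hab']; rfl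
    refine ⟨insert b A, h.isCoherent_insert hA fun x hx y hy => ?_, ?_⟩
    · rw [h.swap_left, h.swap_right, hG1 x hx y hy, hiso x hx, hiso y hy]; rfl
    · rw [Finset.card_insert_of_notMem (Finset.mem_compl.1 hb)]; omega

end IsK4FreeTwoGraph

/-! ### Blow-ups of the pentagon with an isolated vertex. -/

/-- The disjoint union of the pentagon `0, 1, 2, 3, 4` and the isolated vertex `5`. -/
def pentagon (i j : Fin 6) : Bool :=
  (![![false, true, false, false, true, false],
    ![true, false, true, false, false, false],
    ![false, true, false, true, false, false],
    ![false, false, true, false, true, false],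
    ![true, false, false, true, false, false],
    ![false, false, false, false, false, false]] : Fin 6 → Fin 6 → Bool) i j

/-- The triples spanning an odd number of edges of a graph. -/
def oddTriple {V : Type*} (G : V → V → Bool) (x y z : V) : Bool := G x y ^^ G x z ^^ G y z

theorem oddTriple_pentagon_k4free : ∀ i j k l : Fin 6,
    ¬ (oddTriple pentagon i j k = true ∧ oddTriple pentagon i j l = true ∧
      oddTriple pentagon i k l = true ∧ oddTriple pentagon j k l = true) := by
  decide +kernel

theorem card_le_of_isCoherent_pentagon : ∀ C : Finset (Fin 6),
    (∀ i ∈ C, ∀ j ∈ C, ∀ k ∈ C, oddTriple pentagon i j k = false) → C.card ≤ 3 := by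
  decide +kernel

/-- Here `e` is the link adjacency of a further vertex to the six given ones, so that vertex must be
a twin of one of them. -/
theorem exists_pentagon_eq : ∀ e : Fin 6 → Bool, e 5 = false →
    (∀ j k l, ¬ ((e j ^^ e k ^^ pentagon j k) = true ∧ (e j ^^ e l ^^ pentagon j l) = true ∧
      (e k ^^ e l ^^ pentagon k l) = true ∧ oddTriple pentagon j k l = true)) →
    ∃ i, ∀ j, e j = pentagon i j := by
  decide +kernel

/-- Here `b` is the link adjacency between a twin of `i` and a twin of `j`: it is forced, so the
twin classes form a genuine blow-up. -/
theorem eq_pentagon : ∀ (i j : Fin 6) (b : Bool),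
    (∀ k l, ¬ ((b ^^ pentagon i k ^^ pentagon j k) = true ∧
      (b ^^ pentagon i l ^^ pentagon j l) = true ∧
      (pentagon i k ^^ pentagon i l ^^ pentagon k l) = true ∧
      (pentagon j k ^^ pentagon j l ^^ pentagon k l) = true)) → b = pentagon i j := by
  decide +kernel

namespace IsK4FreeTwoGraph

variable {V : Type*} {T : V → V → V → Bool} [Fintype V]

theorem exists_isCoherent_of_pentagon (h : IsK4FreeTwoGraph T) {v : V} {p : Fin 6 → V}
    (hv : p 5 = v) (hp : ∀ i j, T v (p i) (p j) = pentagon i j) :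
    ∃ S, IsCoherent T S ∧ (Fintype.card V / 2 + 1 ≤ S.card ∨
      (6 ∣ Fintype.card V ∧ Fintype.card V / 2 ≤ S.card)) := by
  have hcls : ∀ x, ∃ i, ∀ j, T v x (p j) = pentagon i j := by
    intro x
    refine exists_pentagon_eq (fun j => T v x (p j)) ?_ fun j k l hc => ?_
    · simp only [hv, h.diag']
    · refine h.k4free x (p j) (p k) (p l) ?_
      simpa only [h.eq_xor v x, h.eq_xor v (p _) (p _) (p _), hp, oddTriple] using hc
  choose c hc using hcls
  have hG : ∀ x y, T v x y = pentagon (c x) (c y) := by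
    intro x y
    refine eq_pentagon _ _ _ fun k l hkl => h.k4free x y (p k) (p l) ?_
    simpa only [h.eq_xor v x, h.eq_xor v y, hp, hc] using hkl
  have hT : ∀ x y z, T x y z = oddTriple pentagon (c x) (c y) (c z) := by
    intro x y z
    rw [h.eq_xor v, hG, hG, hG]; rfl
  let w : Fin 6 → ℕ := fun i => (Finset.univ.filter fun x => c x = i).card
  have hsum : w 0 + w 1 + w 2 + w 3 + w 4 + w 5 = Fintype.card V := by
    rw [← Finset.card_univ, Finset.card_eq_sum_card_fiberwise (f := c) (t := Finset.univ)
      (fun x _ => Finset.mem_coe.2 (Finset.mem_univ _)), Fin.sum_univ_six]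
  by_contra hcon
  push Not at hcon
  have hI : ∀ i j k : Fin 6, i ≠ j → i ≠ k → j ≠ k →
      (∀ a ∈ ({i, j, k} : Finset (Fin 6)), ∀ b ∈ ({i, j, k} : Finset (Fin 6)),
        ∀ d ∈ ({i, j, k} : Finset (Fin 6)), oddTriple pentagon a b d = false) →
      w i + w j + w k < Fintype.card V / 2 + 1 ∧
      (6 ∣ Fintype.card V → w i + w j + w k < Fintype.card V / 2) := by
    intro i j k hij hik hjk hco
    have := hcon (Finset.univ.filter fun x => c x ∈ ({i, j, k} : Finset (Fin 6))) (by
      intro x hx y hy z hz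
      rw [hT]
      exact hco _ (Finset.mem_filter.1 hx).2 _ (Finset.mem_filter.1 hy).2 _
        (Finset.mem_filter.1 hz).2)
    have hcard : (Finset.univ.filter fun x => c x ∈ ({i, j, k} : Finset (Fin 6))).card =
        w i + w j + w k := by
      rw [Finset.card_eq_sum_card_fiberwise (f := c)
        (t := ({i, j, k} : Finset (Fin 6))) (fun x hx => by simpa using hx)]
      have hf : ∀ a ∈ ({i, j, k} : Finset (Fin 6)),
          ((Finset.univ.filter fun x => c x ∈ ({i, j, k} : Finset (Fin 6))).filter
            fun x => c x = a).card = w a := by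
        intro a ha
        congr 1
        ext x
        simp only [Finset.mem_filter, Finset.mem_univ, true_and]
        exact ⟨fun h => h.2, fun h => ⟨h ▸ ha, h⟩⟩
      rw [Finset.sum_congr rfl hf, Finset.sum_insert (by simp [hij, hik]),
        Finset.sum_insert (by simp [hjk]), Finset.sum_singleton, add_assoc]
    rwa [hcard] at this
  -- These ten coherent triples of classes cover each class five times, so their weights sum to five
  -- times the number of vertices.
  have t1 := hI 0 1 2 (by decide) (by decide) (by decide) (by decide)
  have t2 := hI 1 2 3 (by decide) (by decide) (by decide) (by decide)
  have t3 := hI 2 3 4 (by decide) (by decide) (by decide) (by decide)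
  have t4 := hI 3 4 0 (by decide) (by decide) (by decide) (by decide)
  have t5 := hI 4 0 1 (by decide) (by decide) (by decide) (by decide)
  have t6 := hI 5 0 2 (by decide) (by decide) (by decide) (by decide)
  have t7 := hI 5 1 3 (by decide) (by decide) (by decide) (by decide)
  have t8 := hI 5 2 4 (by decide) (by decide) (by decide) (by decide)
  have t9 := hI 5 3 0 (by decide) (by decide) (by decide) (by decide)
  have t10 := hI 5 4 1 (by decide) (by decide) (by decide) (by decide)
  clear hI hcon hG hT hc hp
  generalize Fintype.card V = n at *
  generalize w 0 = w0, w 1 = w1, w 2 = w2, w 3 = w3, w 4 = w4, w 5 = w5 at *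
  have hd : 2 * (n / 2) ≤ n := Nat.mul_div_le n 2
  -- No weight exceeds the average `n / 2`, so all equal it. The six equalities kept make all
  -- classes equal; then `6 ∣ n` and the strict bounds fail.
  have e1 : 2 * (w0 + w1 + w2) = n := by linarith
  have e2 : 2 * (w1 + w2 + w3) = n := by linarith
  have e3 : 2 * (w2 + w3 + w4) = n := by linarith
  have e4 : 2 * (w3 + w4 + w0) = n := by linarith
  have e5 : 2 * (w4 + w0 + w1) = n := by linarith
  have e6 : 2 * (w5 + w0 + w2) = n := by linarith
  omega

theorem exists_isCoherent [DecidableEq V] (h : IsK4FreeTwoGraph T) (hn : 2 ≤ Fintype.card V) :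
    ∃ S, IsCoherent T S ∧ (Fintype.card V / 2 + 1 ≤ S.card ∨
      (6 ∣ Fintype.card V ∧ Fintype.card V / 2 ≤ S.card)) := by
  obtain ⟨v⟩ : Nonempty V := Fintype.card_pos_iff.1 (by omega)
  obtain ⟨a, -, hmax⟩ := Finset.exists_max_image Finset.univ
    (fun a => (Finset.univ.filter fun b => T v a b = true).card) ⟨v, Finset.mem_univ _⟩
  have hcomm : ∀ x y, T v x y = T v y x := h.swap_right v
  have htri : ∀ x y z, ¬ (T v x y = true ∧ T v x z = true ∧ T v y z = true) := by
    rintro x y z ⟨h1, h2, h3⟩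
    exact h.k4free v x y z ⟨h1, h2, h3, by rw [h.eq_xor v, h1, h2, h3]; rfl⟩
  have hco : ∀ S : Finset V, (∀ x ∈ S, ∀ y ∈ S, T v x y = false) → IsCoherent T S := by
    intro S hS x hx y hy z hz
    rw [h.eq_xor v, hS x hx y hy, hS x hx z hz, hS y hy z hz]; rfl
  have hB : IsCoherent T (Finset.univ.filter fun b => T v a b = true) := by
    refine hco _ fun x hx y hy => ?_
    by_contra hxy
    exact htri a x y ⟨(Finset.mem_filter.1 hx).2, (Finset.mem_filter.1 hy).2, by simpa using hxy⟩
  by_cases hA : ∀ c d, T v a c = false → T v a d = false → T v c d = false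
  · obtain ⟨S, hS, hcard⟩ := h.exists_isCoherent_of_compl hn
      (A := (Finset.univ.filter fun b => T v a b = true)ᶜ)
      (hco _ fun x hx y hy => hA x y (by simpa using hx) (by simpa using hy))
      (by rwa [compl_compl])
    exact ⟨S, hS, Or.inl hcard⟩
  push Not at hA
  obtain ⟨c, d, hac, had, hcd⟩ := hA
  rw [ne_eq, Bool.not_eq_false] at hcd
  -- Otherwise `ab` and `cd` would be an induced matching in the link.
  have hor : ∀ b, T v a b = true → T v b c = true ∨ T v b d = true := by
    intro b hab
    by_contra! hc
    simp only [ne_eq, Bool.not_eq_true] at hc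
    refine h.k4free a b c d ⟨?_, ?_, ?_, ?_⟩ <;> rw [h.eq_xor v] <;>
      simp [hab, hac, had, hc, hcd]
  have hmiss : ∀ c d, T v a d = false → T v c d = true →
      ∃ b, T v a b = true ∧ T v b c = false := by
    intro c d had hcd
    by_contra! hcon
    refine absurd (hmax c (Finset.mem_univ _)) (not_le.2 (Finset.card_lt_card ?_))
    rw [Finset.ssubset_iff_of_subset]
    · exact ⟨d, by simp [hcd], by simp [had]⟩
    · intro t ht
      rw [Finset.mem_filter] at ht ⊢
      exact ⟨ht.1, by rw [hcomm]; simpa using hcon t ht.2⟩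
  obtain ⟨b, hab, hbc⟩ := hmiss c d had hcd
  obtain ⟨b', hab', hbd'⟩ := hmiss d c hac (by rw [hcomm]; exact hcd)
  have hbd : T v b d = true := (hor b hab).resolve_left (by simp [hbc])
  have hbc' : T v b' c = true := (hor b' hab').resolve_right (by simp [hbd'])
  have hbb : T v b b' = false := by
    by_contra hbb
    exact htri a b b' ⟨hab, hab', by simpa using hbb⟩
  -- Maximality of the degree of `a` gave neighbours `b`, `b'` missing `c`, `d` respectively, which
  -- closes the induced pentagon `a b d c b'`.
  refine h.exists_isCoherent_of_pentagon (p := ![a, b, d, c, b', v]) (v := v) rfl ?_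
  intro i j
  fin_cases i <;> fin_cases j <;>
    simp [pentagon, h.diag, h.diag', h.diag'', hab, hab', hac, had, hbc, hbd, hcd, hbd', hbc', hbb,
      hcomm b a, hcomm b' a, hcomm c a, hcomm d a, hcomm c b, hcomm d b, hcomm d c, hcomm d b',
      hcomm c b', hcomm b' b]

end IsK4FreeTwoGraph

/-! ### Extremal constructions and conclusion. -/

variable {V : Type*} [Fintype V] [DecidableEq V] {G : V → V → Bool}

theorem mem_ofPred_oddTriple (hG : ∀ x y, G x y = G y x) {x y z : V} (hxy : x ≠ y) (hxz : x ≠ z)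
    (hyz : y ≠ z) : {x, y, z} ∈ (ofPred fun x y z => !oddTriple G x y z).edges ↔
      oddTriple G x y z = false := by
  rw [mem_ofPred _ _ hxy hxz hyz]
  · simp
  · intro x y z
    simp only [oddTriple, hG y x]
    cases G x y <;> cases G x z <;> cases G y z <;> rfl
  · intro x y z
    simp only [oddTriple, hG z y]
    cases G x y <;> cases G x z <;> cases G y z <;> rfl

theorem isFree_ofPred_oddTriple (hG : ∀ x y, G x y = G y x)
    (hK : ∀ x y z w, ¬ (oddTriple G x y z = true ∧ oddTriple G x y w = true ∧
      oddTriple G x z w = true ∧ oddTriple G y z w = true)) :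
    (ofPred fun x y z => !oddTriple G x y z).IsFree {(4, 0), (4, 1), (4, 3)} := by
  rw [isFree_iff]
  intro x y z w hxy hxz hxw hyz hyw hzw
  rw [inducedSize_quad _ hxy hxz hxw hyz hyw hzw]
  simp only [mem_ofPred_oddTriple hG, hxy, hxz, hxw, hyz, hyw, hzw, ne_eq, not_false_eq_true]
  have := hK x y z w
  revert this
  rcases Bool.eq_false_or_eq_true (oddTriple G x y z) with h1 | h1 <;>
  rcases Bool.eq_false_or_eq_true (oddTriple G x y w) with h2 | h2 <;>
  rcases Bool.eq_false_or_eq_true (oddTriple G x z w) with h3 | h3 <;>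
  rcases Bool.eq_false_or_eq_true (oddTriple G y z w) with h4 | h4 <;>
  simp only [h1, h2, h3, h4] <;> simp
  all_goals
    revert h1 h2 h3 h4
    simp only [oddTriple]
    cases G x y <;> cases G x z <;> cases G x w <;> cases G y z <;> cases G y w <;>
      cases G z w <;> simp

theorem exists_homNumber_le_half_add_one (n : ℕ) (hn : 4 ≤ n) :
    ∃ H : RGraph 3 (Fin n), H.IsFree {(4, 0), (4, 1), (4, 3)} ∧ H.homNumber ≤ n / 2 + 1 := by
  -- A half graph: even numbers are joined to larger odd ones. Increasing triples of alternating
  -- parity are odd, hence non-edges.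
  let G : Fin n → Fin n → Bool := fun x y => decide
    ((x.val < y.val ∧ x.val % 2 = 0 ∧ y.val % 2 = 1) ∨
      (y.val < x.val ∧ y.val % 2 = 0 ∧ x.val % 2 = 1))
  have hG : ∀ x y, G x y = G y x := by
    intro x y; simp only [G, decide_eq_decide]; tauto
  have hodd : ∀ x y z : Fin n, x < y → y < z → x.val % 2 ≠ y.val % 2 → y.val % 2 ≠ z.val % 2 →
      oddTriple G x y z = true := by
    intro x y z hxy hyz h1 h2
    rw [Fin.lt_def] at hxy hyz
    rcases Nat.mod_two_eq_zero_or_one x.val with hx | hx <;>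
    rcases Nat.mod_two_eq_zero_or_one y.val with hy | hy <;>
    rcases Nat.mod_two_eq_zero_or_one z.val with hz | hz <;>
    simp_all [oddTriple, G] <;> omega
  have hfree : (ofPred fun x y z => !oddTriple G x y z).IsFree {(4, 0), (4, 1), (4, 3)} := by
    refine isFree_ofPred_oddTriple hG fun x y z w => ?_
    rcases Nat.mod_two_eq_zero_or_one x.val with hx | hx <;>
    rcases Nat.mod_two_eq_zero_or_one y.val with hy | hy <;>
    rcases Nat.mod_two_eq_zero_or_one z.val with hz | hz <;>
    rcases Nat.mod_two_eq_zero_or_one w.val with hw | hw <;>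
    simp [oddTriple, G, hx, hy, hz, hw] <;> omega
  refine ⟨_, hfree, homNumber_le (by simp) hfree (by omega) fun S hS => ?_⟩
  rw [isClique_iff] at hS
  have hS' : ∀ x ∈ S, ∀ y ∈ S, ∀ z ∈ S, x < y → y < z → x.val % 2 ≠ y.val % 2 →
      y.val % 2 ≠ z.val % 2 → False := by
    intro x hx y hy z hz hxy hyz h1 h2
    have h3 := (mem_ofPred_oddTriple hG hxy.ne (hxy.trans hyz).ne hyz.ne).1
      (hS x hx y hy z hz hxy.ne (hxy.trans hyz).ne hyz.ne)
    rw [hodd x y z hxy hyz h1 h2] at h3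
    exact absurd h3 (by simp)
  simp only [Fin.lt_def] at hS'
  by_cases hinj : Set.InjOn (fun x : Fin n => x.val / 2) S
  · have := Finset.card_le_card_of_injOn (t := Finset.range (n / 2 + 1)) _
      (fun x _ => by have := x.isLt; simp; omega) hinj
    simpa using this
  have hpair : ∃ x ∈ S, ∃ y ∈ S, x.val % 2 = 0 ∧ y.val = x.val + 1 := by
    simp only [Set.InjOn] at hinj
    push Not at hinj
    obtain ⟨x, hx, y, hy, hxy, hne⟩ := hinj
    rw [Finset.mem_coe] at hx hy
    rw [ne_eq, Fin.ext_iff] at hne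
    rcases lt_or_gt_of_ne hne with h1 | h1
    · exact ⟨x, hx, y, hy, by omega, by omega⟩
    · exact ⟨y, hy, x, hx, by omega, by omega⟩
  obtain ⟨x, hx, y, hy, hx2, hyx⟩ := hpair
  -- Once `S` contains the block `x, x + 1`, its smaller elements are even and its larger ones odd,
  -- so every other block contributes at most one element, and an unpaired last vertex none.
  have hle := Finset.card_le_card_of_injOn (s := S.erase x) (t := Finset.range (n / 2))
    (fun x : Fin n => x.val / 2) (by
      intro s hs
      obtain ⟨hsx, hsS⟩ := Finset.mem_erase.1 hs
      rw [ne_eq, Fin.ext_iff] at hsx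
      simp only [Finset.coe_range, Set.mem_Iio]
      by_contra hc
      have h1 := s.isLt
      have h2 := y.isLt
      exact hS' x hx y hy s hsS (by omega) (by omega) (by omega) (by omega)) (by
      intro s hs t ht hst
      obtain ⟨hsx, hsS⟩ := Finset.mem_erase.1 hs
      obtain ⟨htx, htS⟩ := Finset.mem_erase.1 ht
      rw [ne_eq, Fin.ext_iff] at hsx htx
      simp only at hst
      by_contra hne
      rw [Fin.ext_iff] at hne
      rcases lt_or_gt_of_ne hne with h1 | h1
      · rcases lt_or_ge s.val x.val with h2 | h2
        · exact hS' s hsS t htS x hx (by omega) (by omega) (by omega) (by omega)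
        · exact hS' x hx y hy s hsS (by omega) (by omega) (by omega) (by omega)
      · rcases lt_or_ge s.val x.val with h2 | h2
        · exact hS' t htS s hsS x hx (by omega) (by omega) (by omega) (by omega)
        · exact hS' x hx y hy t htS (by omega) (by omega) (by omega) (by omega))
  rw [Finset.card_erase_of_mem hx, Finset.card_range] at hle
  omega

theorem exists_homNumber_le_half (n : ℕ) (hn : 4 ≤ n) (h6 : 6 ∣ n) :
    ∃ H : RGraph 3 (Fin n), H.IsFree {(4, 0), (4, 1), (4, 3)} ∧ H.homNumber ≤ n / 2 := by
  let c : Fin n → Fin 6 := fun x => ⟨x.val % 6, Nat.mod_lt _ (by norm_num)⟩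
  let G : Fin n → Fin n → Bool := fun x y => pentagon (c x) (c y)
  have hps : ∀ i j, pentagon i j = pentagon j i := by decide
  have hG : ∀ x y, G x y = G y x := fun x y => hps _ _
  have hfree := isFree_ofPred_oddTriple hG fun x y z w =>
    oddTriple_pentagon_k4free (c x) (c y) (c z) (c w)
  refine ⟨_, hfree, homNumber_le (by simp) hfree (by omega) fun S hS => ?_⟩
  rw [isClique_iff] at hS
  have hC : (S.image c).card ≤ 3 := by
    refine card_le_of_isCoherent_pentagon _ ?_
    simp only [Finset.mem_image]
    rintro _ ⟨x, hx, rfl⟩ _ ⟨y, hy, rfl⟩ _ ⟨z, hz, rfl⟩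
    have hdeg : ∀ i j, oddTriple pentagon i i j = false ∧ oddTriple pentagon i j i = false ∧
        oddTriple pentagon i j j = false := by decide
    rcases eq_or_ne x y with rfl | hxy
    · exact (hdeg _ _).1
    rcases eq_or_ne x z with rfl | hxz
    · exact (hdeg _ _).2.1
    rcases eq_or_ne y z with rfl | hyz
    · exact (hdeg _ _).2.2
    exact (mem_ofPred_oddTriple hG hxy hxz hyz).1 (hS x hx y hy z hz hxy hxz hyz)
  -- Residues modulo 6 give classes of size `n / 6`, and a clique meets at most three.
  have hfib : S.card ≤ n / 6 * (S.image c).card := by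
    refine Finset.card_le_mul_card_image _ _ fun i _ => ?_
    have := Finset.card_le_card_of_injOn (s := S.filter fun x => c x = i)
      (t := Finset.range (n / 6)) (fun x : Fin n => x.val / 6)
      (fun x _ => by have := x.isLt; simp; omega) (by
        intro x hx y hy hxy
        have h1 := (Finset.mem_filter.1 hx).2
        rw [← (Finset.mem_filter.1 hy).2] at h1
        simp only [c, Fin.mk.injEq] at h1
        simp only at hxy
        rw [Fin.ext_iff]
        omega)
    simpa using this
  calc S.card ≤ n / 6 * (S.image c).card := hfib
    _ ≤ n / 6 * 3 := Nat.mul_le_mul_left _ hC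
    _ ≤ n / 2 := by omega

theorem le_homNumber_of_isFree {n : ℕ} (hn : 4 ≤ n) {H : RGraph 3 (Fin n)}
    (hH : H.IsFree {(4, 0), (4, 1), (4, 3)}) :
    n / 2 + 1 ≤ H.homNumber ∨ (6 ∣ n ∧ n / 2 ≤ H.homNumber) := by
  obtain ⟨S, hS, hcard⟩ := (isK4FreeTwoGraph_nonEdge hH).exists_isCoherent
    (by rw [Fintype.card_fin]; omega)
  rw [Fintype.card_fin] at hcard
  have := card_le_homNumber (isClique_of_isCoherent hS)
  omega

theorem isMinHomNumber_two_or_four (n : ℕ) (hn : 4 ≤ n) :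
    IsMinHomNumber 3 n {(4, 0), (4, 1), (4, 3)} (if 6 ∣ n then n / 2 else n / 2 + 1) := by
  split_ifs with h6
  · obtain ⟨H, hH, hle⟩ := exists_homNumber_le_half n hn h6
    refine ⟨⟨H, hH, le_antisymm hle ?_⟩, ?_⟩
    · have := le_homNumber_of_isFree hn hH
      omega
    · rintro j ⟨H', hH', rfl⟩
      have := le_homNumber_of_isFree hn hH'
      omega
  · obtain ⟨H, hH, hle⟩ := exists_homNumber_le_half_add_one n hn
    refine ⟨⟨H, hH, le_antisymm hle ?_⟩, ?_⟩
    · have := le_homNumber_of_isFree hn hH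
      omega
    · rintro j ⟨H', hH', rfl⟩
      have := le_homNumber_of_isFree hn hH'
      omega

end TwoOrFour

end RGraph

theorem Nat.ceil_add_one_div_two (n : ℕ) : ⌈((n : ℚ) + 1) / 2⌉₊ = n / 2 + 1 := by
  rw [Nat.ceil_eq_iff (by omega)]
  obtain ⟨m, hm⟩ := Nat.even_or_odd' n
  have h2 : n / 2 = m := by omega
  rw [h2]
  rcases hm with rfl | rfl <;> push_cast <;> constructor <;> linarith

theorem theorem4 (n : ℕ) (hn : 4 ≤ n) :
    IsMinHomNumber 3 n {(4, 0), (4, 2), (4, 3)} (n - 1) ∧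
    IsMinHomNumber 3 n {(4, 0), (4, 1), (4, 3)}
      (if n ≡ 0 [MOD 6] then n / 2 else ⌈((n : ℚ) + 1) / 2⌉₊) := by
  refine ⟨RGraph.isMinHomNumber_one_or_four n hn, ?_⟩
  simpa only [Nat.modEq_zero_iff_dvd, Nat.ceil_add_one_div_two] using
    RGraph.isMinHomNumber_two_or_four n hn
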